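/- All graphs are finite and simple. The treedepth $\mathrm{td}(G)$ of a graph $G$ is the least integer $d\ge 0$ for which there is a rooted forest $F$ of depth at most $d-1$ (that is, with at most $d$ levels) with vertex set $V(G)$ such that every edge of $G$ joins a vertex to one of its ancestors or descendants in $F$. For a function $r\colon\mathbb N\to\mathbb R_{\ge 0}$, a graph $G$ is fractionally $\mathrm{td}$-fragile at rate $r$ if for every integer $a\ge 1$ there is a probability distribution on the sets $Y\subseteq V(G)$ with $\mathrm{td}(G-Y)\le r(a)$ such that each vertex of $G$ belongs to the random set $Y$ with probability at most $1/a$. A graph is outerplanar if it can be drawn in the plane without crossings so that all its vertices lie on the boundary of the outer face. Let $P_n$ be the path with $n$ vertices. For a graph $H$ and an integer $d\ge 0$, the graph $T_d(H)$ is defined as follows: $T_0(H)$ is a single vertex, its handle; for $d\ge 1$, $T_d(H)$ is obtained from $H$ by adding, for each $x\in V(H)$, a copy of $T_{d-1}(H)$ and identifying its handle with $x$, and finally adding a new vertex, the handle of $T_d(H)$, adjacent to all vertices of $H$. Theorem. (i) For all integers $d\ge 0$, $a\ge 1$ and $n\ge 2^a$, $\mathrm{td}(T_d(P_n))\ge ad+1$.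 (ii) For every integer $d\ge 0$, the graph $T_d(P_d)$ is outerplanar. There are constants $c>0$ and $a_0\in\mathbb N$ such that for all integers $d\ge a\ge a_0$ and every non-decreasing function $r\colon\mathbb N\to\mathbb R_{\ge 0}$, if $T_d(P_d)$ is fractionally $\mathrm{td}$-fragile at rate $r$, then $r(a)\ge c\,a\log a$. (iii) Let $r\colon\mathbb N\to\mathbb R_{\ge 0}$ be a non-decreasing function. If all outerplanar graphs are fractionally $\mathrm{td}$-fragile at rate $r$, then $r(a)=\Omega(a\log a)$ as $a\to\infty$. -/

import Mathlib

open scoped NNReal Topology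

namespace TdFragile

/-! ## Treedepth -/

/-- A rooted forest with vertex set `V`: `parent v = none` means that `v` is a root, and `depth v`
is the number of edges between `v` and the root of its tree (the two depth conditions determine
`depth` from `parent`, and rule out cycles and infinite ascending sequences of parents). -/
structure RootedForest (V : Type*) where
  parent : V → Option V
  depth : V → ℕ
  depth_root : ∀ v, parent v = none → depth v = 0
  depth_child : ∀ v u, parent v = some u → depth v = depth u + 1

/-- `u` is `v` itself or one of the vertices on the path from `v` to the root of its tree. -/
def RootedForest.IsAncestor {V : Type*} (F : RootedForest V) (u v : V) : Prop :=
  Relation.ReflTransGen (fun x y => F.parent x = some y) v u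

/-- `F` has depth at most `d - 1` (that is, at most `d` levels), and every edge of `G` joins a
vertex to one of its ancestors or descendants in `F`. -/
def RootedForest.Witnesses {V : Type*} (F : RootedForest V) (G : SimpleGraph V) (d : ℕ) : Prop :=
  (∀ v, F.depth v < d) ∧ ∀ u v, G.Adj u v → F.IsAncestor u v ∨ F.IsAncestor v u

/-- The treedepth of a (finite) graph. -/
noncomputable def treedepth {V : Type*} (G : SimpleGraph V) : ℕ :=
  sInf {d | ∃ F : RootedForest V, F.Witnesses G d}

/-- Treedepth as a real-valued graph parameter. -/
noncomputable def td (V : Type) (G : SimpleGraph V) : ℝ := treedepth G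

/-! ## Fractional fragility -/

/-- The sets `Y` of vertices of `G` such that `f (G - Y) ≤ b`. -/
def deletionSets (f : (V : Type) → SimpleGraph V → ℝ) {V : Type} (G : SimpleGraph V) (b : ℝ) :
    Set (Finset V) :=
  {Y | f {v : V // v ∉ Y} (G.induce {v : V | v ∉ Y}) ≤ b}

open Classical in
/-- A probability distribution `μ` on the subsets of `V` is `ε`-thin if every vertex belongs
to a random set sampled from `μ` with probability at most `ε`. -/
def IsThin {V : Type} [Fintype V] (μ : Finset V → ℝ) (ε : ℝ) : Prop :=
  ∀ v : V, ∑ X : Finset V with v ∈ X, μ X ≤ ε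

/-- `G` is fractionally `f`-fragile at rate `r`. The elements `μ` of
`stdSimplex ℝ (Finset V)` are the probability distributions on the subsets of `V`. -/
def FractionallyFragile (f : (V : Type) → SimpleGraph V → ℝ) (r : ℕ → ℝ≥0)
    {V : Type} [Fintype V] (G : SimpleGraph V) : Prop :=
  ∀ a : ℕ, 1 ≤ a → ∃ μ ∈ stdSimplex ℝ (Finset V),
    IsThin μ (1 / (a : ℝ)) ∧ ∀ X, μ X ≠ 0 → X ∈ deletionSets f G (r a)

/-! ## Outerplanar graphs -/

/-- `A` is a simple arc in the plane with ends `p` and `q`. -/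
def IsArc (A : Set (ℝ × ℝ)) (p q : ℝ × ℝ) : Prop :=
  ∃ γ : Path p q, Function.Injective γ ∧ Set.range γ = A

/-- A drawing of `G` in the plane without crossings: vertices are distinct points, an edge `uv`
is a simple arc between the points of `u` and `v` containing no other vertex, and two distinct
edges may only meet in points that represent vertices (hence only in common end-vertices). -/
structure PlaneDrawing {V : Type*} (G : SimpleGraph V) where
  point : V → ℝ × ℝ
  arc : Sym2 V → Set (ℝ × ℝ)
  point_injective : Function.Injective point
  isArc : ∀ u v, G.Adj u v → IsArc (arc s(u, v)) (point u) (point v)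
  mem_of_point_mem_arc : ∀ e ∈ G.edgeSet, ∀ w, point w ∈ arc e → w ∈ e
  arc_inter_arc : ∀ e ∈ G.edgeSet, ∀ e' ∈ G.edgeSet, e ≠ e' → arc e ∩ arc e' ⊆ Set.range point

/-- The set of points of the plane covered by the drawing. -/
def PlaneDrawing.support {V : Type*} {G : SimpleGraph V} (D : PlaneDrawing G) : Set (ℝ × ℝ) :=
  Set.range D.point ∪ ⋃ e ∈ G.edgeSet, D.arc e

/-- The unbounded component of the complement of the (compact) set `K` in the plane. -/
def outerFace (K : Set (ℝ × ℝ)) : Set (ℝ × ℝ) :=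
  {x | x ∈ Kᶜ ∧ ¬ Bornology.IsBounded (connectedComponentIn Kᶜ x)}

/-- A (finite) graph is outerplanar if it has a drawing in the plane without crossings in which
all vertices lie on the boundary of the outer face. -/
def IsOuterplanar {V : Type*} (G : SimpleGraph V) : Prop :=
  ∃ D : PlaneDrawing G, ∀ v, D.point v ∈ closure (outerFace D.support)

/-! ## The graphs `T_d(H)` -/

/-- The vertices of `T_d(H)`, where `H` has vertex set `W`. In `T_{d+1}(H)`, `none` is the handle,
and `some (x, y)` is the vertex `y` of the copy of `T_d(H)` attached at the vertex `x` of `H`.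
The vertex `x` of `H` is identified with the handle of that copy. -/
def TVert (W : Type) : ℕ → Type
  | 0 => Unit
  | d + 1 => Option (W × TVert W d)

instance TVert.instFintype (W : Type) [Fintype W] : (d : ℕ) → Fintype (TVert W d)
  | 0 => inferInstanceAs (Fintype Unit)
  | d + 1 =>
    letI := TVert.instFintype W d
    inferInstanceAs (Fintype (Option (W × TVert W d)))

/-- The handle of `T_d(H)`. -/
def handle (W : Type) : (d : ℕ) → TVert W d
  | 0 => ()
  | _ + 1 => none

/-- Adjacency in `T_d(H)`: the handle of `T_{d+1}(H)` is adjacent to the vertices of `H` (the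
handles of the copies of `T_d(H)`); the other edges are those of the copies and those of `H`. -/
def TAdj {W : Type} (H : SimpleGraph W) : (d : ℕ) → TVert W d → TVert W d → Prop
  | 0, _, _ => False
  | _ + 1, none, none => False
  | d + 1, none, some (_, y) => y = handle W d
  | d + 1, some (_, y), none => y = handle W d
  | d + 1, some (x, y), some (x', y') =>
      (x = x' ∧ TAdj H d y y') ∨ (H.Adj x x' ∧ y = handle W d ∧ y' = handle W d)

theorem TAdj.symm {W : Type} (H : SimpleGraph W) :
    (d : ℕ) → (u v : TVert W d) → TAdj H d u v → TAdj H d v u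
  | 0, _, _, h => h
  | _ + 1, none, none, h => h
  | _ + 1, none, some (_, _), h => h
  | _ + 1, some (_, _), none, h => h
  | d + 1, some (_, y), some (_, y'), h => by
      rcases h with ⟨h1, h2⟩ | ⟨h1, h2, h3⟩
      · exact Or.inl ⟨h1.symm, TAdj.symm H d y y' h2⟩
      · exact Or.inr ⟨h1.symm, h3, h2⟩

theorem TAdj.irrefl {W : Type} (H : SimpleGraph W) :
    (d : ℕ) → (u : TVert W d) → ¬ TAdj H d u u
  | 0, _, h => h
  | _ + 1, none, h => h
  | d + 1, some (x, y), h => by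
      rcases h with ⟨_, h2⟩ | ⟨h1, _⟩
      · exact TAdj.irrefl H d y h2
      · exact H.irrefl h1

/-- The graph `T_d(H)`. -/
def T {W : Type} (d : ℕ) (H : SimpleGraph W) : SimpleGraph (TVert W d) where
  Adj := TAdj H d
  symm := ⟨fun u v h => TAdj.symm H d u v h⟩
  loopless := ⟨fun u h => TAdj.irrefl H d u h⟩

end TdFragile

namespace TdFragile

/-! ## Treedepth by successive vertex removals -/

/-! All bounds on treedepth here are lower bounds, so treedepth is used as a removal game: in each
nonempty connected part, some vertex can be removed so that the rest has treedepth one less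
(`TreedepthLE`). The central object is a row: connected sets, each containing its handle, in
consecutive copies of `T_d(P_n)`. Removing one vertex spoils only one copy, and the copies on either
side still form rows.

Halving a row gives (i): `2 ^ a` copies of treedepth at least `u` force treedepth at least `u + a`
(`add_le_of_treedepthLE_copies`), and each of the `d` levels gains `a`.

For (ii), give mass 1 to each of the levels `0, …, k`. A random set that is `1 / a`-thin has
expected mass at most `(k + 1) / a`, so it suffices that deleting any set of mass `m` leaves
treedepth at least `k * l - K * m - k * c / n` (`exists_connectedOn_le`, `le_of_mem_deletionSets`).
The induction over levels needs copies of unequal treedepth, for which halving becomes an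
exponential sum: lower bounds `u x` along a row of treedepth at most `t` satisfy `∑ exp (u x) ≤ 4 *
exp t`. Deleted handles, `|D|` in number, cut the path into at most `|D| + 1` rows. The inequality
`1 + s ≤ exp s` then makes the bound linear, so that only the average of the `u x` matters, and this
is controlled by the mass. Each level gains `l` at a loss `c / n`. With `l` about `log a`, `c = a /
4`, `n ≥ a` and about `a / 4` levels, the gain is of order `a log a` and the penalty `K * m` takes
on average only about a quarter of it.

Outerplanarity comes from a non-crossing enumeration of the vertices, realised by points on a
parabola joined by chords. Part (iii) applies (ii) to `T_a(P_a)`. -/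

/-- The subgraph of `G` induced by `C` is (pre)connected: a property that spreads along the edges
inside `C` and holds at one vertex of `C` holds on all of `C`. -/
def ConnectedOn {V : Type*} (G : SimpleGraph V) (C : Set V) : Prop :=
  ∀ p : V → Prop, (∀ u ∈ C, ∀ v ∈ C, G.Adj u v → p u → p v) → ∀ u ∈ C, p u → ∀ v ∈ C, p v

/-- The subgraph of `G` induced by `S` has treedepth at most `t`: every connected part of it
becomes a graph of treedepth at most `t - 1` after the removal of some vertex. -/
def TreedepthLE {V : Type*} (G : SimpleGraph V) : ℕ → Set V → Prop
  | 0, S => S = ∅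
  | t + 1, S => ∀ C ⊆ S, C.Nonempty → ConnectedOn G C → ∃ z ∈ C, TreedepthLE G t (C \ {z})

theorem TreedepthLE.mono {V : Type*} {G : SimpleGraph V} {t : ℕ} {S S' : Set V}
    (h : TreedepthLE G t S) (hS : S' ⊆ S) : TreedepthLE G t S' := by
  cases t with
  | zero => exact Set.subset_eq_empty hS h
  | succ t => exact fun C hC => h C (hC.trans hS)

theorem TreedepthLE.exists_removal {V : Type*} {G : SimpleGraph V} {t : ℕ} {C : Set V}
    (h : TreedepthLE G t C) (hne : C.Nonempty) (hC : ConnectedOn G C) :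
    ∃ s, t = s + 1 ∧ ∃ z ∈ C, TreedepthLE G s (C \ {z}) := by
  cases t with
  | zero => exact absurd h hne.ne_empty
  | succ t => exact ⟨t, rfl, h C subset_rfl hne hC⟩

theorem ConnectedOn.image {V V' : Type*} {G : SimpleGraph V} {G' : SimpleGraph V'} {C : Set V}
    (hC : ConnectedOn G C) {φ : V → V'} (hφ : ∀ u v, G.Adj u v → G'.Adj (φ u) (φ v)) :
    ConnectedOn G' (φ '' C) := by
  rintro p hp _ ⟨u, hu, rfl⟩ hpu _ ⟨v, hv, rfl⟩
  exact hC (p ∘ φ)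
    (fun a ha b hb hab => hp _ ⟨a, ha, rfl⟩ _ ⟨b, hb, rfl⟩ (hφ a b hab)) u hu hpu v hv

/-- An edge-preserving injection maps connected parts to connected parts, so the vertex removed from
the image can be pulled back; extra edges in `G'` do no harm. -/
theorem TreedepthLE.of_image {V V' : Type*} {G : SimpleGraph V} {G' : SimpleGraph V'} {φ : V → V'}
    (hinj : Function.Injective φ) (hφ : ∀ u v, G.Adj u v → G'.Adj (φ u) (φ v)) :
    ∀ {t : ℕ} {S : Set V}, TreedepthLE G' t (φ '' S) → TreedepthLE G t S
  | 0, S, h => Set.image_eq_empty.1 h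
  | t + 1, S, h => by
      intro C hCS hne hC
      obtain ⟨_, ⟨z, hz, rfl⟩, hz'⟩ :=
        h (φ '' C) (Set.image_mono hCS) (hne.image φ) (hC.image hφ)
      refine ⟨z, hz, TreedepthLE.of_image hinj hφ (hz'.mono ?_)⟩
      rintro _ ⟨w, ⟨hw, hwz⟩, rfl⟩
      exact ⟨⟨w, hw, rfl⟩, fun e => hwz (hinj e)⟩

theorem TreedepthLE.of_induce {V : Type*} {G : SimpleGraph V} {s : Set V} :
    ∀ {t : ℕ} {A : Set s}, TreedepthLE (G.induce s) t A → TreedepthLE G t (Subtype.val '' A)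
  | 0, A, h => Set.image_eq_empty.2 h
  | t + 1, A, h => by
      intro C hCA hne hC
      have hCs : ∀ v ∈ C, v ∈ s := fun v hv => by
        obtain ⟨w, -, rfl⟩ := hCA hv
        exact w.2
      have hsub : (Subtype.val ⁻¹' C : Set s) ⊆ A := fun w hw => by
        obtain ⟨w', hw', e⟩ := hCA hw
        rwa [← Subtype.ext e]
      have hconn : ConnectedOn (G.induce s) (Subtype.val ⁻¹' C) := by
        intro p hp u hu hpu v hv
        exact hC (fun v => ∀ h : v ∈ s, p ⟨v, h⟩)
          (fun a ha b hb hab hpa hbs => hp ⟨a, hCs a ha⟩ ha ⟨b, hbs⟩ hb hab (hpa _))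
          u hu (fun _ => hpu) v hv v.2
      obtain ⟨v, hv⟩ := hne
      obtain ⟨z, hz, hz'⟩ := h _ hsub ⟨⟨v, hCs v hv⟩, hv⟩ hconn
      refine ⟨z, hz, (TreedepthLE.of_induce hz').mono ?_⟩
      rintro w ⟨hw, hwz⟩
      exact ⟨⟨w, hCs w hw⟩, ⟨hw, fun e => hwz (congrArg Subtype.val e)⟩, rfl⟩

theorem RootedForest.IsAncestor.eq_or_depth_lt {V : Type*} {F : RootedForest V} {u v : V}
    (h : F.IsAncestor u v) : u = v ∨ F.depth u < F.depth v := by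
  induction h with
  | refl => exact Or.inl rfl
  | tail _ h' ih =>
      have := F.depth_child _ _ h'
      rcases ih with rfl | ih
      · right; omega
      · right; omega

theorem RootedForest.IsAncestor.total {V : Type*} {F : RootedForest V} {u v w : V}
    (hu : F.IsAncestor u w) (hv : F.IsAncestor v w) : F.IsAncestor u v ∨ F.IsAncestor v u :=
  (Relation.ReflTransGen.total_of_right_unique
    (fun _ _ _ h h' => Option.some_injective _ (h.symm.trans h')) hv hu)

/-- The induction removes a vertex of least depth. The depths occurring in `S` lie in a window of
length `t` below `d`, which shrinks from its lower end at each removal. -/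
theorem RootedForest.treedepthLE {V : Type*} {G : SimpleGraph V} {F : RootedForest V}
    (hF : ∀ u v, G.Adj u v → F.IsAncestor u v ∨ F.IsAncestor v u) {d : ℕ} :
    ∀ {t : ℕ} {S : Set V}, (∀ v ∈ S, F.depth v < d ∧ d ≤ F.depth v + t) → TreedepthLE G t S
  | 0, S, h => by
      refine Set.eq_empty_of_forall_notMem fun v hv => ?_
      have := h v hv
      omega
  | t + 1, S, h => by
      intro C hCS hne hC
      obtain ⟨z, hz, hmin⟩ := (InvImage.wf F.depth Nat.lt_wfRel.wf).has_min C hne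
      -- Moving along edges inside a connected `C` never leaves the subtree of `z`: a neighbour is
      -- comparable to the current vertex, hence to `z`, and cannot be higher than `z`.
      have hdesc : ∀ v ∈ C, F.IsAncestor z v := by
        refine hC (F.IsAncestor z) (fun u _ v hv huv hu => ?_) z hz Relation.ReflTransGen.refl
        rcases hF u v huv with h' | h'
        · exact Relation.ReflTransGen.trans h' hu
        · rcases hu.total h' with h'' | h''
          · exact h''
          · rcases h''.eq_or_depth_lt with rfl | h''
            · exact Relation.ReflTransGen.refl
            · exact absurd h'' (hmin v hv)
      refine ⟨z, hz, RootedForest.treedepthLE (d := d) hF fun v hv => ?_⟩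
      have h₁ := h v (hCS hv.1)
      have h₂ := h z (hCS hz)
      rcases (hdesc v hv.1).eq_or_depth_lt with rfl | h₃
      · exact absurd rfl hv.2
      · omega

theorem TreedepthLE.of_witnesses {V : Type*} {G : SimpleGraph V} {F : RootedForest V} {d : ℕ}
    (h : F.Witnesses G d) : TreedepthLE G d Set.univ :=
  RootedForest.treedepthLE h.2 fun v _ => ⟨h.1 v, by omega⟩

/-- The path on `V` given by an enumeration of its elements. -/
def RootedForest.chain {V : Type*} {n : ℕ} (e : V ≃ Fin n) : RootedForest V where
  parent v := if h : (e v : ℕ) = 0 then none else some (e.symm ⟨e v - 1, by omega⟩)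
  depth v := e v
  depth_root v h := by by_contra h0; simp [h0] at h
  depth_child v u h := by
    by_cases h0 : (e v : ℕ) = 0
    · simp [h0] at h
    · rw [dif_neg h0, Option.some.injEq] at h
      subst h
      simp
      omega

theorem RootedForest.chain_isAncestor {V : Type*} {n : ℕ} (e : V ≃ Fin n) (v : V) :
    ∀ (k : ℕ) (u : V), (e u : ℕ) = e v + k → (RootedForest.chain e).IsAncestor v u
  | 0, u, h => by
      have : u = v := e.injective (Fin.ext h)
      subst this
      exact Relation.ReflTransGen.refl
  | k + 1, u, h => by
      have h0 : (e u : ℕ) ≠ 0 := by omega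
      refine Relation.ReflTransGen.head (b := e.symm ⟨e u - 1, by omega⟩) ?_
        (RootedForest.chain_isAncestor e v k _ (by simp; omega))
      simp [RootedForest.chain, h0]

/-- Since `sInf ∅ = 0` in `ℕ`, the infimum defining treedepth is attained only once some forest is
known to exist; a single path through all the vertices serves. -/
theorem exists_witnesses {V : Type*} [Fintype V] (G : SimpleGraph V) :
    ∃ d, ∃ F : RootedForest V, F.Witnesses G d := by
  let e := Fintype.equivFin V
  refine ⟨Fintype.card V, RootedForest.chain e, fun v => (e v).2, fun u v _ => ?_⟩
  rcases le_total (e u : ℕ) (e v) with h | h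
  · exact Or.inl (RootedForest.chain_isAncestor e u (e v - e u) v (by omega))
  · exact Or.inr (RootedForest.chain_isAncestor e v (e u - e v) u (by omega))

theorem treedepthLE_treedepth {V : Type*} [Fintype V] (G : SimpleGraph V) :
    TreedepthLE G (treedepth G) Set.univ := by
  obtain ⟨F, hF⟩ := Nat.sInf_mem (exists_witnesses G)
  exact TreedepthLE.of_witnesses hF

/-! ## Copies along a path -/

section Copies

variable {n d : ℕ}

/-- The union of the sets `C x`, for `x ∈ I`, in the copies of `T_d(P_n)` inside `T_{d+1}(P_n)`. -/
def copies (C : Fin n → Set (TVert (Fin n) d)) (I : Finset (Fin n)) : Set (TVert (Fin n) (d + 1)) :=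
  {v | ∃ x ∈ I, ∃ y ∈ C x, v = some (x, y)}

theorem copies_mono {C : Fin n → Set (TVert (Fin n) d)} {I J : Finset (Fin n)} (h : I ⊆ J) :
    copies C I ⊆ copies C J := by
  rintro _ ⟨x, hx, y, hy, rfl⟩
  exact ⟨x, h hx, y, hy, rfl⟩

theorem T_adj_copy {W : Type} {H : SimpleGraph W} {d : ℕ} (x : W) (u v : TVert W d)
    (h : (T d H).Adj u v) : (T (d + 1) H).Adj (some (x, u)) (some (x, v)) :=
  Or.inl ⟨rfl, h⟩

theorem TreedepthLE.copy {C : Fin n → Set (TVert (Fin n) d)} {I : Finset (Fin n)} {t : ℕ}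
    {H : SimpleGraph (Fin n)} (h : TreedepthLE (T (d + 1) H) t (copies C I)) {x : Fin n}
    (hx : x ∈ I) : TreedepthLE (T d H) t (C x) := by
  refine TreedepthLE.of_image (φ := fun y => (some (x, y) : TVert (Fin n) (d + 1))) ?_
    (T_adj_copy x) (h.mono ?_)
  · intro y y' e
    exact (Prod.mk.inj (Option.some_injective _ e)).2
  · rintro _ ⟨y, hy, rfl⟩
    exact ⟨x, hx, y, hy, rfl⟩

theorem connectedOn_copy {H : SimpleGraph (Fin n)} {C : Fin n → Set (TVert (Fin n) d)}
    {x : Fin n} (hC : ConnectedOn (T d H) (C x))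
    {p : TVert (Fin n) (d + 1) → Prop} {S : Set (TVert (Fin n) (d + 1))}
    (hS : ∀ y ∈ C x, some (x, y) ∈ S)
    (hp : ∀ u ∈ S, ∀ v ∈ S, (T (d + 1) H).Adj u v → p u → p v) {y y' : TVert (Fin n) d}
    (hy : y ∈ C x) (hy' : y' ∈ C x) (h : p (some (x, y))) : p (some (x, y')) :=
  hC (fun y => p (some (x, y)))
    (fun u hu v hv huv => hp _ (hS u hu) _ (hS v hv) (T_adj_copy x u v huv)) y hy h y' hy'

/-- The handles of consecutive copies are adjacent, so a property spreads from copy to copy along an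
interval and then within each copy. -/
theorem connectedOn_copies {C : Fin n → Set (TVert (Fin n) d)} {I : Finset (Fin n)}
    (hI : (I : Set (Fin n)).OrdConnected)
    (hC : ∀ x ∈ I, handle (Fin n) d ∈ C x ∧ ConnectedOn (T d (SimpleGraph.pathGraph n)) (C x)) :
    ConnectedOn (T (d + 1) (SimpleGraph.pathGraph n)) (copies C I) := by
  rintro p hp _ ⟨x, hx, y, hy, rfl⟩ hpu _ ⟨x', hx', y', hy', rfl⟩
  have hcopy : ∀ x ∈ I, ∀ y ∈ C x, ∀ y' ∈ C x, p (some (x, y)) → p (some (x, y')) :=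
    fun x hx y hy y' hy' => connectedOn_copy (hC x hx).2 (S := copies C I) (fun y hy => ⟨x, hx, y, hy, rfl⟩) hp hy hy'
  have hstep : ∀ x ∈ I, ∀ x' ∈ I, (SimpleGraph.pathGraph n).Adj x x' →
      p (some (x, handle (Fin n) d)) → p (some (x', handle (Fin n) d)) := fun x hx x' hx' h =>
    hp _ ⟨x, hx, _, (hC x hx).1, rfl⟩ _ ⟨x', hx', _, (hC x' hx').1, rfl⟩ (Or.inr ⟨h, rfl, rfl⟩)
  have hpath : ∀ k : ℕ, ∀ x ∈ I, ∀ x' ∈ I, (x' : ℕ) = x + k →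
      (p (some (x, handle (Fin n) d)) ↔ p (some (x', handle (Fin n) d))) := by
    intro k
    induction k with
    | zero =>
        intro x _ x' _ h
        rw [Fin.ext h]
    | succ k ih =>
        intro x hx x' hx' h
        have hlt : (x : ℕ) + k < n := by omega
        have hm : (⟨x + k, hlt⟩ : Fin n) ∈ I :=
          hI.out hx hx' ⟨Fin.le_def.2 (by simp), Fin.le_def.2 (by simp; omega)⟩
        rw [ih x hx _ hm rfl]
        have hadj : (SimpleGraph.pathGraph n).Adj ⟨x + k, hlt⟩ x' := by
          rw [SimpleGraph.pathGraph_adj]; left; simp; omega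
        exact ⟨hstep _ hm _ hx' hadj, hstep _ hx' _ hm hadj.symm⟩
  refine hcopy x' hx' _ (hC x' hx').1 _ hy' ?_
  have hpx := hcopy x hx _ hy _ (hC x hx).1 hpu
  rcases le_total (x : ℕ) x' with h | h
  · exact (hpath (x' - x) x hx x' hx' (by omega)).1 hpx
  · exact (hpath (x - x') x' hx' x hx (by omega)).2 hpx

theorem ordConnected_filter_lt {I : Finset (Fin n)} (hI : (I : Set (Fin n)).OrdConnected)
    (x : Fin n) : ((I.filter (· < x) : Finset (Fin n)) : Set (Fin n)).OrdConnected := by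
  rw [Finset.coe_filter]
  exact hI.inter Set.ordConnected_Iio

theorem ordConnected_filter_gt {I : Finset (Fin n)} (hI : (I : Set (Fin n)).OrdConnected)
    (x : Fin n) : ((I.filter (x < ·) : Finset (Fin n)) : Set (Fin n)).OrdConnected := by
  rw [Finset.coe_filter]
  exact hI.inter Set.ordConnected_Ioi

theorem sum_split {M : Type*} [AddCommMonoid M] {I : Finset (Fin n)} {x : Fin n} (hx : x ∈ I)
    (f : Fin n → M) :
    ∑ y ∈ I, f y = ∑ y ∈ I.filter (· < x), f y + ∑ y ∈ I.filter (x < ·), f y + f x := by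
  have h : I = insert x (I.filter (· < x) ∪ I.filter (x < ·)) := by
    ext y
    simp only [Finset.mem_insert, Finset.mem_union, Finset.mem_filter]
    rcases lt_trichotomy y x with h | h | h <;> grind
  conv_lhs => rw [h]
  rw [Finset.sum_insert (by simp), Finset.sum_union, add_comm]
  rw [Finset.disjoint_left]
  intro y h1 h2
  exact lt_asymm (Finset.mem_filter.1 h1).2 (Finset.mem_filter.1 h2).2

/-- Removing a vertex from a row of copies leaves the copies on both sides intact. -/
theorem TreedepthLE.exists_split {C : Fin n → Set (TVert (Fin n) d)} {I : Finset (Fin n)} {t : ℕ}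
    (hI : (I : Set (Fin n)).OrdConnected) (hne : I.Nonempty)
    (hC : ∀ x ∈ I, handle (Fin n) d ∈ C x ∧ ConnectedOn (T d (SimpleGraph.pathGraph n)) (C x))
    (h : TreedepthLE (T (d + 1) (SimpleGraph.pathGraph n)) t (copies C I)) :
    ∃ s, t = s + 1 ∧ ∃ x ∈ I,
      TreedepthLE (T (d + 1) (SimpleGraph.pathGraph n)) s (copies C (I.filter (· < x))) ∧
      TreedepthLE (T (d + 1) (SimpleGraph.pathGraph n)) s (copies C (I.filter (x < ·))) := by
  obtain ⟨x, hx⟩ := hne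
  obtain ⟨s, hs, _, ⟨x, hx, y, hy, rfl⟩, h'⟩ := h.exists_removal
    ⟨_, ⟨x, hx, _, (hC x hx).1, rfl⟩⟩ (connectedOn_copies hI hC)
  refine ⟨s, hs, x, hx, h'.mono ?_, h'.mono ?_⟩ <;>
  · rintro _ ⟨x', hx', y', hy', rfl⟩
    rw [Finset.mem_filter] at hx'
    refine ⟨⟨x', hx'.1, y', hy', rfl⟩, fun e => ?_⟩
    have := (Prod.mk.inj (Option.some_injective _ e)).1
    subst this
    exact lt_irrefl _ hx'.2

/-- Binary search: the removed vertex leaves one side holding at least half as many intact copies,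
rounded down to a power of two. -/
theorem add_le_of_treedepthLE_copies {C : Fin n → Set (TVert (Fin n) d)} {u : ℕ}
    (hu : ∀ x, ∀ t, TreedepthLE (T d (SimpleGraph.pathGraph n)) t (C x) → u ≤ t)
    (hC : ∀ x, handle (Fin n) d ∈ C x ∧ ConnectedOn (T d (SimpleGraph.pathGraph n)) (C x)) :
    ∀ (b t : ℕ) (I : Finset (Fin n)), (I : Set (Fin n)).OrdConnected → 2 ^ b ≤ I.card →
      TreedepthLE (T (d + 1) (SimpleGraph.pathGraph n)) t (copies C I) → u + b ≤ t := by
  intro b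
  induction b with
  | zero =>
      intro t I _ hcard h
      obtain ⟨x, hx⟩ := Finset.card_pos.1 (by omega : 0 < I.card)
      exact hu x t (h.copy hx)
  | succ b ih =>
      intro t I hI hcard h
      have h2 : 0 < 2 ^ b := by positivity
      rw [pow_succ] at hcard
      obtain ⟨s, rfl, x, hx, h₁, h₂⟩ :=
        h.exists_split hI (Finset.card_pos.1 (by omega)) fun x _ => hC x
      have hsum := sum_split hx fun _ => 1
      simp only [← Finset.card_eq_sum_ones] at hsum
      -- The two sides together keep at least `2 * 2 ^ b - 1` copies, so one of them has at least `2
      -- ^ b`.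
      rcases le_or_gt (2 ^ b) (I.filter (· < x)).card with h' | h'
      · have := ih s _ (ordConnected_filter_lt hI x) h' h₁
        omega
      · have := ih s _ (ordConnected_filter_gt hI x) (by omega) h₂
        omega

/-- A Kraft-type inequality, replacing halving when the copies have different treedepths: the copy
that is hit contributes at most `exp t`, and both sides have treedepth one less. -/
theorem sum_exp_le_of_treedepthLE_copies {C : Fin n → Set (TVert (Fin n) d)} {u : Fin n → ℝ} :
    ∀ (t : ℕ) (I : Finset (Fin n)), (I : Set (Fin n)).OrdConnected →
      (∀ x ∈ I, handle (Fin n) d ∈ C x ∧ ConnectedOn (T d (SimpleGraph.pathGraph n)) (C x)) →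
      (∀ x ∈ I, ∀ t : ℕ, TreedepthLE (T d (SimpleGraph.pathGraph n)) t (C x) → u x ≤ t) →
      TreedepthLE (T (d + 1) (SimpleGraph.pathGraph n)) t (copies C I) →
      ∑ x ∈ I, Real.exp (u x) ≤ 4 * Real.exp t := by
  intro t
  induction t with
  | zero =>
      intro I hI hC hu h
      rcases I.eq_empty_or_nonempty with rfl | hne
      · simp
      · obtain ⟨s, hs, -⟩ := h.exists_split hI hne hC
        omega
  | succ t ih =>
      intro I hI hC hu h
      rcases I.eq_empty_or_nonempty with rfl | hne
      · simp only [Finset.sum_empty]; positivity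
      obtain ⟨s, hs, x, hx, h₁, h₂⟩ := h.exists_split hI hne hC
      obtain rfl : t = s := by omega
      have e₁ := ih _ (ordConnected_filter_lt hI x)
        (fun y hy => hC y (Finset.mem_filter.1 hy).1)
        (fun y hy => hu y (Finset.mem_filter.1 hy).1) h₁
      have e₂ := ih _ (ordConnected_filter_gt hI x)
        (fun y hy => hC y (Finset.mem_filter.1 hy).1)
        (fun y hy => hu y (Finset.mem_filter.1 hy).1) h₂
      have e₃ := Real.exp_le_exp.2 (hu x hx _ (h.copy hx))
      rw [sum_split hx]
      push_cast [Real.exp_add] at e₃ ⊢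
      -- The constant 4 survives the induction because `4 + 4 + e ≤ 4 * e`, that is, `e ≥ 8 / 3`.
      have := Real.exp_one_gt_d9
      have := Real.exp_pos (t : ℝ)
      nlinarith

/-- Cutting the interval at a point of `D` splits the other `m - 1` points of `D` between the two
sides, and `(m₁ + 1) + (m₂ + 1) = m + 1`; an interval without points of `D` is a single row. -/
theorem sum_exp_le_of_treedepthLE {C : Fin n → Set (TVert (Fin n) d)} {u : Fin n → ℝ}
    {D : Finset (Fin n)}
    (hC : ∀ x ∉ D, handle (Fin n) d ∈ C x ∧ ConnectedOn (T d (SimpleGraph.pathGraph n)) (C x))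
    (hu : ∀ x ∉ D, ∀ t : ℕ, TreedepthLE (T d (SimpleGraph.pathGraph n)) t (C x) → u x ≤ t) {t : ℕ} :
    ∀ (m : ℕ) (I : Finset (Fin n)), (I.filter (· ∈ D)).card = m →
      (I : Set (Fin n)).OrdConnected →
      TreedepthLE (T (d + 1) (SimpleGraph.pathGraph n)) t (copies C (I.filter (· ∉ D))) →
      ∑ x ∈ I.filter (· ∉ D), Real.exp (u x) ≤ 4 * (m + 1) * Real.exp t := by
  intro m
  induction m using Nat.strong_induction_on with
  | _ m ih =>
    intro I hm hI h
    rcases (I.filter (· ∈ D)).eq_empty_or_nonempty with he | ⟨x, hx⟩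
    · have hnD : ∀ x ∈ I, x ∉ D := fun x hx hxD => by
        have := Finset.mem_filter.2 ⟨hx, hxD⟩
        simp [he] at this
      rw [Finset.filter_true_of_mem hnD] at h ⊢
      have := sum_exp_le_of_treedepthLE_copies t I hI (fun x hx => hC x (hnD x hx))
        (fun x hx => hu x (hnD x hx)) h
      rw [he] at hm
      subst hm
      simpa using this
    · obtain ⟨hxI, hxD⟩ := Finset.mem_filter.1 hx
      have hcard := sum_split hxI fun y => if y ∈ D then 1 else 0
      simp only [Finset.sum_boole, hxD, if_true, Nat.cast_id] at hcard
      rw [hm] at hcard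
      have e₁ := ih _ (by omega) (I.filter (· < x)) rfl (ordConnected_filter_lt hI x)
        (h.mono (copies_mono (Finset.filter_subset_filter _ (Finset.filter_subset _ _))))
      have e₂ := ih _ (by omega) (I.filter (x < ·)) rfl (ordConnected_filter_gt hI x)
        (h.mono (copies_mono (Finset.filter_subset_filter _ (Finset.filter_subset _ _))))
      have e₃ := sum_split hxI fun y => if y ∉ D then Real.exp (u y) else 0
      simp only [← Finset.sum_filter, hxD, not_true, if_false] at e₃
      rw [e₃]
      rw [hcard]
      push_cast
      linarith

end Copies

/-! ### Treedepth of the undeleted graphs -/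

theorem connectedOn_T_univ {n : ℕ} :
    ∀ d : ℕ, ConnectedOn (T d (SimpleGraph.pathGraph n)) Set.univ
  | 0 => fun p _ u _ hu v _ => hu
  | d + 1 => by
      intro p hp u _ hu v _
      have hn : ∀ w, p w ↔ p (handle (Fin n) (d + 1)) := by
        have hc : ∀ x, ∀ y y', p (some (x, y)) → p (some (x, y')) := fun x y y' =>
          connectedOn_copy (C := fun _ => Set.univ) (S := Set.univ)
            (connectedOn_T_univ d) (fun _ _ => trivial) hp trivial trivial
        rintro (_ | ⟨x, y⟩)
        · exact Iff.rfl
        · have hadj : (T (d + 1) (SimpleGraph.pathGraph n)).Adj (handle (Fin n) (d + 1))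
              (some (x, handle (Fin n) d)) := rfl
          exact ⟨fun h => hp _ trivial _ trivial hadj.symm (hc x y _ h),
            fun h => hc x _ y (hp _ trivial _ trivial hadj h)⟩
      exact (hn v).2 ((hn u).1 hu)

/-- The treedepth of `T_d(P_n)`. -/
theorem le_of_treedepthLE_T {n a : ℕ} (hn : 2 ^ a ≤ n) :
    ∀ d t : ℕ, TreedepthLE (T d (SimpleGraph.pathGraph n)) t Set.univ → a * d + 1 ≤ t
  | 0, t, h => by
      obtain ⟨s, rfl, -⟩ := h.exists_removal ⟨handle _ 0, trivial⟩ (connectedOn_T_univ 0)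
      omega
  | d + 1, t, h => by
      have := add_le_of_treedepthLE_copies (C := fun _ => Set.univ)
        (fun _ => le_of_treedepthLE_T hn d) (fun _ => ⟨trivial, connectedOn_T_univ d⟩) a t
        Finset.univ (by simpa using Set.ordConnected_univ) (by simpa using hn)
        (h.mono (Set.subset_univ _))
      rw [Nat.mul_succ]
      omega

/-! ## Rates of fragility of `T_d(P_n)` -/

/-- The weight on the vertices of `T_d(P_n)` which gives total weight `1` to the vertices on each
of the levels `0, …, k`, uniformly distributed over the level, and weight `0` to the others. -/
noncomputable def levelWeight (n : ℕ) : (k d : ℕ) → TVert (Fin n) d → ℝ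
  | _, 0, _ => 1
  | _, _ + 1, none => 1
  | 0, _ + 1, some _ => 0
  | k + 1, d + 1, some (_, y) => levelWeight n k d y / n

theorem levelWeight_nonneg (n : ℕ) : ∀ (k d : ℕ) (v : TVert (Fin n) d), 0 ≤ levelWeight n k d v
  | 0, 0, _ => zero_le_one
  | _ + 1, 0, _ => zero_le_one
  | 0, _ + 1, none => zero_le_one
  | _ + 1, _ + 1, none => zero_le_one
  | 0, _ + 1, some _ => le_rfl
  | k + 1, d + 1, some (_, y) => div_nonneg (levelWeight_nonneg n k d y) n.cast_nonneg

theorem levelWeight_handle (n : ℕ) : ∀ k d : ℕ, levelWeight n k d (handle (Fin n) d) = 1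
  | 0, 0 => rfl
  | _ + 1, 0 => rfl
  | 0, _ + 1 => rfl
  | _ + 1, _ + 1 => rfl

theorem sum_TVert_succ {W : Type} [Fintype W] {d : ℕ} (f : TVert W (d + 1) → ℝ) :
    ∑ v, f v = f (handle W (d + 1)) + ∑ x, ∑ y, f (some (x, y)) := by
  rw [← Fintype.sum_prod_type' (f := fun x y => f (some (x, y)))]
  exact Fintype.sum_option (α := W × TVert W d) f

theorem sum_levelWeight_le {n : ℕ} (hn : 0 < n) :
    ∀ k d : ℕ, ∑ v, levelWeight n k d v ≤ k + 1
  | k, 0 => by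
      have : ∑ v, levelWeight n k 0 v = 1 := by
        refine (Fintype.sum_unique (ι := Unit) _).trans ?_
        exact levelWeight_handle n k 0
      rw [this]
      have : (0 : ℝ) ≤ k := k.cast_nonneg
      linarith
  | 0, d + 1 => by
      rw [sum_TVert_succ, levelWeight_handle]
      simp [levelWeight]
  | k + 1, d + 1 => by
      rw [sum_TVert_succ, levelWeight_handle]
      have ih := sum_levelWeight_le hn k d
      have hn' : (0 : ℝ) < n := by exact_mod_cast hn
      simp only [levelWeight, ← Finset.sum_div, Finset.sum_const, Finset.card_univ,
        Fintype.card_fin, nsmul_eq_mul]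
      rw [mul_div_cancel_left₀ _ hn'.ne']
      push_cast
      linarith

/-- The total weight of the vertices in `Y`. -/
noncomputable def levelMass (n k d : ℕ) (Y : Set (TVert (Fin n) d)) : ℝ :=
  ∑ v, Y.indicator (levelWeight n k d) v

theorem levelMass_nonneg (n k d : ℕ) (Y : Set (TVert (Fin n) d)) : 0 ≤ levelMass n k d Y :=
  Finset.sum_nonneg fun _ _ => Set.indicator_nonneg (fun v _ => levelWeight_nonneg n k d v) _

theorem one_le_levelMass {n k d : ℕ} {Y : Set (TVert (Fin n) d)} (h : handle (Fin n) d ∈ Y) :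
    1 ≤ levelMass n k d Y := by
  rw [← levelWeight_handle n k d, ← Set.indicator_of_mem h (levelWeight n k d)]
  exact Finset.single_le_sum (f := Y.indicator (levelWeight n k d))
    (fun _ _ => Set.indicator_nonneg (fun v _ => levelWeight_nonneg n k d v) _) (Finset.mem_univ _)

/-- Each copy carries the weight of `T_d(P_n)` scaled by `1 / n`, with one level fewer; the mass of
a set avoiding the handle is thus the average of its masses in the copies. -/
theorem levelMass_succ {n k d : ℕ} {Y : Set (TVert (Fin n) (d + 1))}
    (h : handle (Fin n) (d + 1) ∉ Y) :
    levelMass n (k + 1) (d + 1) Y =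
      (∑ x, levelMass n k d {y | (some (x, y) : TVert (Fin n) (d + 1)) ∈ Y}) / n := by
  unfold levelMass
  rw [sum_TVert_succ, Set.indicator_of_notMem h, zero_add, Finset.sum_div]
  refine Finset.sum_congr rfl fun x _ => ?_
  rw [Finset.sum_div]
  refine Finset.sum_congr rfl fun y _ => ?_
  by_cases hy : (some (x, y) : TVert (Fin n) (d + 1)) ∈ Y
  · exact (Set.indicator_of_mem hy (levelWeight n (k + 1) (d + 1))).trans
      (congrArg (· / (n : ℝ)) (Set.indicator_of_mem (by exact hy) (levelWeight n k d)).symm)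
  · exact (Set.indicator_of_notMem hy (levelWeight n (k + 1) (d + 1))).trans
      ((congrArg (· / (n : ℝ)) (Set.indicator_of_notMem (by exact hy) (levelWeight n k d))).trans
        (zero_div _)).symm

theorem connectedOn_handle_copies {n d : ℕ} {H : SimpleGraph (Fin n)}
    {C : Fin n → Set (TVert (Fin n) d)} {I : Finset (Fin n)}
    (hC : ∀ x ∈ I, handle (Fin n) d ∈ C x ∧ ConnectedOn (T d H) (C x)) :
    ConnectedOn (T (d + 1) H) (insert (handle (Fin n) (d + 1)) (copies C I)) := by
  intro p hp u hu hpu v hv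
  have hn : ∀ w ∈ insert (handle (Fin n) (d + 1)) (copies C I),
      (p w ↔ p (handle (Fin n) (d + 1))) := by
    rintro _ (rfl | ⟨x, hx, y, hy, rfl⟩)
    · exact Iff.rfl
    · have hmem : ∀ y ∈ C x, (some (x, y) : TVert (Fin n) (d + 1)) ∈
          insert (handle (Fin n) (d + 1)) (copies C I) :=
        fun y hy => Or.inr ⟨x, hx, y, hy, rfl⟩
      have hadj : (T (d + 1) H).Adj (handle (Fin n) (d + 1)) (some (x, handle (Fin n) d)) := rfl
      have hh := (hC x hx).1
      exact ⟨fun h => hp _ (hmem _ hh) _ (Or.inl rfl) hadj.symm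
          (connectedOn_copy (hC x hx).2 hmem hp hy hh h),
        fun h => connectedOn_copy (hC x hx).2 hmem hp hh hy
          (hp _ (Or.inl rfl) _ (hmem _ hh) hadj h)⟩
  exact (hn v hv).2 ((hn u hu).1 hpu)

/-- Deleting a set of small weight from `T_d(P_n)` leaves a graph of large treedepth. -/
theorem exists_connectedOn_le {n : ℕ} (hn : 0 < n) {l c K : ℝ} (hl : 0 ≤ l)
    (hc : c = 4 * Real.exp (l - 1)) :
    ∀ (k d : ℕ), k ≤ d → (k + 1) * l + c ≤ K → ∀ Y : Set (TVert (Fin n) d),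
      handle (Fin n) d ∉ Y → ∃ C : Set (TVert (Fin n) d), Disjoint C Y ∧ handle (Fin n) d ∈ C ∧
        ConnectedOn (T d (SimpleGraph.pathGraph n)) C ∧
        ∀ t : ℕ, TreedepthLE (T d (SimpleGraph.pathGraph n)) t C →
          k * l - K * levelMass n k d Y - k * c / n ≤ t := by
  have hn' : (0 : ℝ) < n := by exact_mod_cast hn
  have hc0 : 0 ≤ c := by rw [hc]; positivity
  intro k
  induction k with
  | zero =>
      intro d _ hK Y hY
      refine ⟨{handle (Fin n) d}, by simpa using hY, rfl, ?_, fun t _ => ?_⟩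
      · rintro p - u rfl hu v rfl
        exact hu
      · have := levelMass_nonneg n 0 d Y
        have : 0 ≤ K := by push_cast at hK; linarith
        have : (0 : ℝ) ≤ t := t.cast_nonneg
        have : 0 ≤ K * levelMass n 0 d Y := by positivity
        simp only [Nat.cast_zero, zero_mul, zero_div]
        linarith
  | succ k ih =>
      intro d hkd hK Y hY
      obtain ⟨d, rfl⟩ : ∃ d', d = d' + 1 := ⟨d - 1, by omega⟩
      push_cast at hK
      have hK' : (k + 1) * l + c ≤ K := by linarith
      have hK0 : 0 ≤ K := le_trans (by positivity) hK'
      classical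
      set Z : Fin n → Set (TVert (Fin n) d) :=
        fun x => {y | (some (x, y) : TVert (Fin n) (d + 1)) ∈ Y} with hZ
      set D : Finset (Fin n) := Finset.univ.filter fun x => handle (Fin n) d ∈ Z x with hD
      have hDmem : ∀ x, x ∈ D ↔ handle (Fin n) d ∈ Z x := fun x => by simp [hD]
      have hex : ∀ x, ∃ C : Set (TVert (Fin n) d), x ∉ D → Disjoint C (Z x) ∧
          handle (Fin n) d ∈ C ∧ ConnectedOn (T d (SimpleGraph.pathGraph n)) C ∧
          ∀ t : ℕ, TreedepthLE (T d (SimpleGraph.pathGraph n)) t C →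
            k * l - K * levelMass n k d (Z x) - k * c / n ≤ t := fun x => by
        by_cases hx : x ∈ D
        · exact ⟨∅, fun h => absurd hx h⟩
        · obtain ⟨C, hC⟩ := ih d (by omega) hK' (Z x) (fun h => hx ((hDmem x).2 h))
          exact ⟨C, fun _ => hC⟩
      choose C hC using hex
      set u : Fin n → ℝ := fun x => k * l - K * levelMass n k d (Z x) - k * c / n with hu
      set I : Finset (Fin n) := Finset.univ.filter (· ∉ D) with hI
      have hCI : ∀ x ∈ I, x ∉ D := fun x hx => (Finset.mem_filter.1 hx).2
      refine ⟨insert (handle (Fin n) (d + 1)) (copies C I), ?_, Or.inl rfl,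
        connectedOn_handle_copies fun x hx => ⟨(hC x (hCI x hx)).2.1, (hC x (hCI x hx)).2.2.1⟩,
        fun t ht => ?_⟩
      · rw [Set.disjoint_left]
        rintro _ (rfl | ⟨x, hx, y, hy, rfl⟩) hv
        · exact hY hv
        · exact Set.disjoint_left.1 (hC x (hCI x hx)).1 hy hv
      have hsum := sum_exp_le_of_treedepthLE (D := D) (u := u)
        (fun x hx => ⟨(hC x hx).2.1, (hC x hx).2.2.1⟩) (fun x hx => (hC x hx).2.2.2) (t := t)
        D.card Finset.univ (by simp) (by simpa using Set.ordConnected_univ)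
        (ht.mono (Set.subset_insert _ _))
      rw [← hI] at hsum
      -- With `s = l - 1 - t + u x`, the bound `1 + s ≤ exp s` linearises the exponential sum; this
      -- is where `c = 4 * exp (l - 1)` comes from.
      have hgood : ∑ x ∈ I, (l + u x - t) ≤ c * (D.card + 1) := by
        calc ∑ x ∈ I, (l + u x - t)
            ≤ ∑ x ∈ I, Real.exp (l - 1 - t) * Real.exp (u x) := by
              refine Finset.sum_le_sum fun x _ => ?_
              rw [← Real.exp_add]
              have := Real.add_one_le_exp (l - 1 - t + u x)
              linarith
          _ = Real.exp (l - 1 - t) * ∑ x ∈ I, Real.exp (u x) := by rw [Finset.mul_sum]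
          _ ≤ Real.exp (l - 1 - t) * (4 * (D.card + 1) * Real.exp t) := by gcongr
          _ = c * (D.card + 1) * (Real.exp (-t) * Real.exp t) := by
              rw [hc, sub_eq_add_neg (l - 1), Real.exp_add]
              ring
          _ = c * (D.card + 1) := by rw [← Real.exp_add]; simp
      -- A deleted handle has mass 1 in its copy, and the penalty `K` is large enough to push the
      -- term down to `-c`. This pays for the extra row that the deletion may create, so the total
      -- over all `x` is at most a single `c`.
      have hbad : ∑ x ∈ D, (l + u x - t) ≤ ∑ x ∈ D, -c := by
        refine Finset.sum_le_sum fun x hx => ?_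
        have h₁ := one_le_levelMass (k := k) ((hDmem x).1 hx)
        have h₂ : K * 1 ≤ K * levelMass n k d (Z x) := mul_le_mul_of_nonneg_left h₁ hK0
        have h₃ : 0 ≤ k * c / n := by positivity
        have h₄ : (0 : ℝ) ≤ t := t.cast_nonneg
        simp only [hu]
        linarith
      have htot : ∑ x, (l + u x - t) = ∑ x ∈ D, (l + u x - t) + ∑ x ∈ I, (l + u x - t) := by
        rw [hI, ← Finset.sum_filter_add_sum_filter_not Finset.univ (· ∈ D)]
        simp
      have hval : ∑ x, (l + u x - t) =
          n * ((k + 1) * l - k * c / n - t) - K * ∑ x, levelMass n k d (Z x) := by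
        rw [Finset.mul_sum]
        have : (n : ℝ) * ((k + 1) * l - k * c / n - t) =
            ∑ x : Fin n, ((k + 1) * l - k * c / n - t) := by
          rw [Finset.sum_const, Finset.card_univ, Fintype.card_fin, nsmul_eq_mul]
        rw [this, ← Finset.sum_sub_distrib]
        refine Finset.sum_congr rfl fun x _ => ?_
        simp only [hu]
        ring
      rw [Finset.sum_const, nsmul_eq_mul] at hbad
      rw [levelMass_succ hY]
      have hfin : n * ((k + 1) * l - k * c / n - t) - K * ∑ x, levelMass n k d (Z x) ≤ c := by
        rw [← hval, htot]
        linarith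
      have hdiv : ((k + 1) * l - k * c / n - t) - K * (∑ x, levelMass n k d (Z x)) / n ≤ c / n := by
        rw [le_div_iff₀ hn']
        refine le_trans (le_of_eq ?_) hfin
        field_simp
      push_cast
      have e : (k + 1) * c / n = k * c / n + c / n := by ring
      rw [e, ← mul_div_assoc]
      linarith

/-! ### From a single deleted set to a random one -/

theorem le_of_mem_deletionSets {n : ℕ} (hn : 0 < n) {l c K : ℝ} (hl : 0 ≤ l)
    (hc : c = 4 * Real.exp (l - 1)) {k d : ℕ} (hkd : k ≤ d) (hK : (k + 1) * l + c ≤ K)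
    {Y : Finset (TVert (Fin n) d)} {b : ℝ}
    (hY : Y ∈ deletionSets td (T d (SimpleGraph.pathGraph n)) b) :
    k * l - K * levelMass n k d Y - k * c / n ≤ b := by
  classical
  have htd : (treedepth ((T d (SimpleGraph.pathGraph n)).induce {v | v ∉ Y}) : ℝ) ≤ b := hY
  refine le_trans ?_ htd
  have hle := (treedepthLE_treedepth
    ((T d (SimpleGraph.pathGraph n)).induce {v | v ∉ Y})).of_induce
  -- If the handle is deleted, the mass is at least 1 and the penalty `K` already makes the
  -- left-hand side nonpositive.
  by_cases h : handle (Fin n) d ∈ (Y : Set (TVert (Fin n) d))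
  · have hc0 : 0 ≤ c := by rw [hc]; positivity
    have h₁ := one_le_levelMass (k := k) h
    have hK0 : 0 ≤ K := le_trans (by positivity) hK
    have h₂ : K * 1 ≤ K * levelMass n k d Y := mul_le_mul_of_nonneg_left h₁ hK0
    have h₃ : 0 ≤ k * c / n := by positivity
    have h₄ : (0 : ℝ) ≤ treedepth ((T d (SimpleGraph.pathGraph n)).induce {v | v ∉ Y}) :=
      Nat.cast_nonneg _
    linarith
  · obtain ⟨C, hCY, -, -, hC⟩ := exists_connectedOn_le hn hl hc k d hkd hK Y h
    refine hC _ (hle.mono fun v hv => ?_)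
    exact ⟨⟨v, fun hv' => Set.disjoint_left.1 hCY hv hv'⟩, trivial, rfl⟩

/-- The expected mass is computed vertex by vertex, by exchanging the two sums. -/
theorem sum_mul_levelMass_le {n : ℕ} (hn : 0 < n) (k d : ℕ) {μ : Finset (TVert (Fin n) d) → ℝ}
    {ε : ℝ} (hε : 0 ≤ ε) (hμ : IsThin μ ε) :
    ∑ Y, μ Y * levelMass n k d Y ≤ ε * (k + 1) := by
  classical
  calc ∑ Y, μ Y * levelMass n k d Y
      = ∑ v, levelWeight n k d v * ∑ Y : Finset (TVert (Fin n) d) with v ∈ Y, μ Y := by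
        simp only [levelMass, Finset.mul_sum, Finset.sum_filter]
        rw [Finset.sum_comm]
        refine Finset.sum_congr rfl fun v _ => Finset.sum_congr rfl fun Y _ => ?_
        by_cases h : v ∈ Y
        · rw [Set.indicator_of_mem (by exact h), if_pos h, mul_comm]
        · rw [Set.indicator_of_notMem (by exact h), if_neg h, mul_zero, mul_zero]
    _ ≤ ∑ v, levelWeight n k d v * ε := by
        refine Finset.sum_le_sum fun v _ => mul_le_mul_of_nonneg_left ?_ (levelWeight_nonneg n k d v)
        convert hμ v
    _ = ε * ∑ v, levelWeight n k d v := by rw [← Finset.sum_mul, mul_comm]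
    _ ≤ ε * (k + 1) := mul_le_mul_of_nonneg_left (sum_levelWeight_le hn k d) hε

theorem FractionallyFragile.le_rate {n : ℕ} (hn : 0 < n) {l c K : ℝ} (hl : 0 ≤ l)
    (hc : c = 4 * Real.exp (l - 1)) {k d : ℕ} (hkd : k ≤ d) (hK : (k + 1) * l + c ≤ K)
    {r : ℕ → ℝ≥0} (h : FractionallyFragile td r (T d (SimpleGraph.pathGraph n))) {a : ℕ}
    (ha : 1 ≤ a) : k * l - K * (1 / a * (k + 1)) - k * c / n ≤ r a := by
  obtain ⟨μ, ⟨hμ0, hμ1⟩, hthin, hsupp⟩ := h a ha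
  have hc0 : 0 ≤ c := by rw [hc]; positivity
  have hK0 : 0 ≤ K := le_trans (by positivity) hK
  have hmass := sum_mul_levelMass_le hn k d (by positivity) hthin
  have hpt : ∀ Y, μ Y * (k * l - k * c / n) - K * (μ Y * levelMass n k d Y) ≤ μ Y * r a := by
    intro Y
    by_cases hY : μ Y = 0
    · simp [hY]
    · have h₁ := le_of_mem_deletionSets hn hl hc hkd hK (hsupp Y hY)
      have h₂ := mul_le_mul_of_nonneg_left h₁ (hμ0 Y)
      linarith
  have hsum := Finset.sum_le_sum fun Y (_ : Y ∈ Finset.univ) => hpt Y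
  rw [Finset.sum_sub_distrib, ← Finset.sum_mul, ← Finset.sum_mul, ← Finset.mul_sum, hμ1] at hsum
  have := mul_le_mul_of_nonneg_left hmass hK0
  linarith

theorem FractionallyFragile.mul_log_le {a d : ℕ} (ha : 256 ≤ a) (had : a ≤ d) {r : ℕ → ℝ≥0}
    (h : FractionallyFragile td r (T d (SimpleGraph.pathGraph d))) :
    1 / 32 * ((a : ℝ) * Real.log a) ≤ r a := by
  have haR : (256 : ℝ) ≤ a := by exact_mod_cast ha
  have ha0 : (0 : ℝ) < a := by linarith
  have hadR : (a : ℝ) ≤ d := by exact_mod_cast had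
  set x := Real.log (a : ℝ) with hx
  have hlog2 := Real.log_two_gt_d9
  have h256 : Real.log 256 = 8 * Real.log 2 := by
    rw [show (256 : ℝ) = 2 ^ 8 by norm_num, Real.log_pow]; norm_num
  have h16 : Real.log 16 = 4 * Real.log 2 := by
    rw [show (16 : ℝ) = 2 ^ 4 by norm_num, Real.log_pow]; norm_num
  have hxge : 8 * Real.log 2 ≤ x := h256 ▸ Real.log_le_log (by norm_num) haR
  -- Chosen so that `c = 4 * exp (l - 1)` equals `a / 4`; as `n = d ≥ a`, each level then loses at
  -- most `1 / 4`.
  set l : ℝ := 1 + (x - Real.log 16) with hl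
  have hl1 : x / 2 ≤ l := by rw [hl, h16]; linarith
  have hc : (a : ℝ) / 4 = 4 * Real.exp (l - 1) := by
    rw [hl, add_sub_cancel_left, Real.exp_sub, hx, Real.exp_log ha0, Real.exp_log (by norm_num)]
    ring
  -- With `k + 1 = ⌊a / 4⌋` levels, the expected mass is at most `1 / 4`, so the penalty costs at
  -- most a quarter of `K`.
  obtain ⟨k, hk⟩ : ∃ k, a / 4 = k + 1 := ⟨a / 4 - 1, by omega⟩
  have hk1 : 4 * ((k : ℝ) + 1) ≤ a := by
    have : 4 * (k + 1) ≤ a := by omega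
    exact_mod_cast this
  have hk2 : (a : ℝ) ≤ 4 * ((k : ℝ) + 1) + 4 := by
    have : a ≤ 4 * (k + 1) + 4 := by omega
    exact_mod_cast this
  have hmain := h.le_rate (by omega : 0 < d) (l := l) (by linarith) hc (k := k) (by omega) le_rfl
    (by omega : 1 ≤ a)
  have e₁ : 1 / (a : ℝ) * (k + 1) ≤ 1 / 4 := by
    rw [one_div, inv_mul_le_iff₀ ha0]
    linarith
  have e₂ : k * (a / 4 : ℝ) / d ≤ a / 16 := by
    rw [div_le_iff₀ (by linarith)]
    nlinarith
  have hl0 : 0 ≤ l := by linarith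
  have e₃ : ((k + 1) * l + a / 4) * (1 / (a : ℝ) * (k + 1)) ≤ ((k + 1) * l + a / 4) * (1 / 4) :=
    mul_le_mul_of_nonneg_left e₁ (by positivity)
  have e₄ : l * (a / 8) ≤ l * (k - (k + 1) / 4) := mul_le_mul_of_nonneg_left (by linarith) hl0
  have e₅ : x / 2 * (a / 8) ≤ l * (a / 8) := mul_le_mul_of_nonneg_right hl1 (by positivity)
  have e₆ : 4 * (a : ℝ) ≤ x * a := mul_le_mul_of_nonneg_right (by linarith) ha0.le
  linarith

/-! ## Outerplanar drawings with the vertices on a parabola -/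

/-- The region above the parabola `y = x ^ 2` contains its chords. -/
theorem convex_parabola : Convex ℝ {p : ℝ × ℝ | p.1 ^ 2 ≤ p.2} := by
  have h : ConvexOn ℝ Set.univ fun x : ℝ => x ^ 2 := even_two.convexOn_pow
  simpa using h.convex_epigraph

theorem mem_chord {a b : ℝ} (hab : a ≤ b) {p : ℝ × ℝ} (hp : p ∈ segment ℝ (a, a ^ 2) (b, b ^ 2)) :
    a ≤ p.1 ∧ p.1 ≤ b ∧ p.1 ^ 2 - p.2 = (p.1 - a) * (p.1 - b) := by
  obtain ⟨s, t, hs, ht, hst, rfl⟩ := hp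
  obtain rfl : s = 1 - t := by linarith
  simp only [Prod.smul_mk, Prod.mk_add_mk, smul_eq_mul]
  refine ⟨by nlinarith, by nlinarith, by ring⟩

theorem exists_chord {V : Type*} {G : SimpleGraph V} {f : V → ℝ} (hf : Function.Injective f)
    {e : Sym2 V} (he : e ∈ G.edgeSet) : ∃ u v, G.Adj u v ∧ f u < f v ∧ e = s(u, v) := by
  induction e with
  | _ u v =>
    have huv : G.Adj u v := he
    rcases lt_trichotomy (f u) (f v) with h | h | h
    · exact ⟨u, v, huv, h, rfl⟩
    · exact absurd (hf h) huv.ne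
    · exact ⟨v, u, huv.symm, h, Sym2.eq_swap⟩

theorem convexHull_image_sym2 {V : Type*} (P : V → ℝ × ℝ) (u v : V) :
    convexHull ℝ (P '' {w | w ∈ s(u, v)}) = segment ℝ (P u) (P v) := by
  have : {w | w ∈ s(u, v)} = ({u, v} : Set V) := by ext w; simp
  rw [this, Set.image_pair, convexHull_pair]

theorem isArc_segment {p q : ℝ × ℝ} (h : p ≠ q) : IsArc (segment ℝ p q) p q :=
  ⟨Path.segment p q, fun _ _ hst => Subtype.ext (AffineMap.lineMap_injective ℝ h hst),
    Path.range_segment p q⟩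

/-- The straight-line drawing with the vertices on the parabola `y = x ^ 2`. -/
def parabolaDrawing {V : Type*} (G : SimpleGraph V) (f : V → ℝ) (hf : Function.Injective f)
    (hG : ∀ u v u' v', G.Adj u v → G.Adj u' v' → f u < f u' → f u' < f v → f v < f v' → False) :
    PlaneDrawing G where
  point v := (f v, f v ^ 2)
  -- The convex hull of the ends depends only on the unordered pair; it is the segment between them.
  arc e := convexHull ℝ ((fun v => (f v, f v ^ 2)) '' {w | w ∈ e})
  point_injective u v h := hf (Prod.mk.inj h).1
  isArc u v huv := by
    rw [convexHull_image_sym2]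
    exact isArc_segment fun h => huv.ne (hf (Prod.mk.inj h).1)
  mem_of_point_mem_arc := by
    intro e he w hw
    obtain ⟨u, v, -, huv, rfl⟩ := exists_chord hf he
    rw [convexHull_image_sym2] at hw
    obtain ⟨-, -, h⟩ := mem_chord huv.le hw
    rw [sub_self, eq_comm, mul_eq_zero, sub_eq_zero, sub_eq_zero] at h
    rcases h with h | h <;> simp [hf h]
  arc_inter_arc := by
    rintro e he e' he' hne p ⟨hp, hp'⟩
    obtain ⟨u, v, huv, hlt, rfl⟩ := exists_chord hf he
    obtain ⟨u', v', huv', hlt', rfl⟩ := exists_chord hf he'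
    rw [convexHull_image_sym2] at hp hp'
    obtain ⟨h₁, h₂, h₃⟩ := mem_chord hlt.le hp
    obtain ⟨h₁', h₂', h₃'⟩ := mem_chord hlt'.le hp'
    by_cases hpar : p.1 ^ 2 - p.2 = 0
    · have hp2 : p.2 = p.1 ^ 2 := by linarith
      rw [hpar, eq_comm, mul_eq_zero, sub_eq_zero, sub_eq_zero] at h₃
      rcases h₃ with h | h
      · exact ⟨u, Prod.ext h.symm (by simp [hp2, h])⟩
      · exact ⟨v, Prod.ext h.symm (by simp [hp2, h])⟩
    · exfalso
      have g := h₃ ▸ hpar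
      have g' := h₃' ▸ hpar
      rw [mul_eq_zero, not_or, sub_eq_zero, sub_eq_zero] at g g'
      have k₁ := lt_of_le_of_ne h₁ (Ne.symm g.1)
      have k₂ := lt_of_le_of_ne h₂ g.2
      have k₁' := lt_of_le_of_ne h₁' (Ne.symm g'.1)
      have k₂' := lt_of_le_of_ne h₂' g'.2
      rw [h₃] at h₃'
      -- Both chords have the same value of `(x - a) * (x - b)` at this interior abscissa.
      -- Non-crossing intervals that overlap are nested, and the product is strictly more negative
      -- on the larger one; so the intervals, and hence the edges, coincide.
      rcases lt_trichotomy (f u) (f u') with h | h | h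
      · have h' : f v' ≤ f v :=
          not_lt.1 fun h' => hG u v u' v' huv huv' h (k₁'.trans k₂) h'
        nlinarith [mul_pos (sub_pos.2 h) (sub_pos.2 k₂),
          mul_nonneg (sub_nonneg.2 h') (sub_pos.2 k₁').le]
      · have e : f v = f v' := by
          rw [h] at h₃'
          have := mul_left_cancel₀ (sub_ne_zero.2 g'.1) h₃'
          linarith
        exact hne (by rw [hf h, hf e])
      · have h' : f v ≤ f v' :=
          not_lt.1 fun h' => hG u' v' u v huv' huv h (k₁.trans k₂') h'
        nlinarith [mul_pos (sub_pos.2 h) (sub_pos.2 k₂'),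
          mul_nonneg (sub_nonneg.2 h') (sub_pos.2 k₁).le]

/-- The map `(x, s) ↦ (x, x ^ 2 - s)` carries an open half-plane onto this region. -/
theorem isPreconnected_below_parabola : IsPreconnected {p : ℝ × ℝ | p.2 < p.1 ^ 2} := by
  have hc : IsPreconnected (Set.univ ×ˢ Set.Ioi (0 : ℝ) : Set (ℝ × ℝ)) :=
    isPreconnected_univ.prod isPreconnected_Ioi
  have : {p : ℝ × ℝ | p.2 < p.1 ^ 2} =
      (fun p : ℝ × ℝ => (p.1, p.1 ^ 2 - p.2)) '' (Set.univ ×ˢ Set.Ioi (0 : ℝ)) := by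
    ext ⟨x, y⟩
    constructor
    · intro h
      exact ⟨(x, x ^ 2 - y), ⟨trivial, Set.mem_Ioi.2 (sub_pos.2 h)⟩, by simp⟩
    · rintro ⟨⟨x', s⟩, ⟨-, hs⟩, h⟩
      obtain ⟨rfl, rfl⟩ := Prod.mk.inj h
      have : 0 < s := hs
      show x' ^ 2 - s < x' ^ 2
      linarith
  rw [this]
  exact hc.image _ (by fun_prop)

theorem not_isBounded_below_parabola : ¬ Bornology.IsBounded {p : ℝ × ℝ | p.2 < p.1 ^ 2} := by
  intro h
  obtain ⟨R, hR⟩ := isBounded_iff_forall_norm_le.1 h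
  have h₁ := hR (0, -(|R| + 1)) (by
    show -(|R| + 1) < (0 : ℝ) ^ 2
    have := abs_nonneg R
    linarith)
  have h₂ := (norm_snd_le ((0, -(|R| + 1)) : ℝ × ℝ)).trans h₁
  rw [norm_neg, Real.norm_eq_abs] at h₂
  have := le_abs_self (|R| + 1)
  have := le_abs_self R
  linarith

/-- The drawing stays on or above the parabola. The region below is connected and unbounded, hence
inside the outer face, and every vertex is a limit of points descending vertically into it. -/
theorem isOuterplanar_of_noncrossing {V : Type*} (G : SimpleGraph V) (f : V → ℝ)
    (hf : Function.Injective f)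
    (hG : ∀ u v u' v', G.Adj u v → G.Adj u' v' → f u < f u' → f u' < f v → f v < f v' → False) :
    IsOuterplanar G := by
  refine ⟨parabolaDrawing G f hf hG, fun v => ?_⟩
  have hsupp : (parabolaDrawing G f hf hG).support ⊆ {p : ℝ × ℝ | p.1 ^ 2 ≤ p.2} := by
    refine Set.union_subset ?_ (Set.iUnion₂_subset fun e _ => ?_)
    · rintro _ ⟨w, rfl⟩
      exact le_refl (f w ^ 2)
    · refine convexHull_min ?_ convex_parabola
      rintro _ ⟨w, -, rfl⟩
      exact le_refl (f w ^ 2)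
  have hbelow : {p : ℝ × ℝ | p.2 < p.1 ^ 2} ⊆ (parabolaDrawing G f hf hG).supportᶜ :=
    fun p hp hp' => (not_le.2 (Set.mem_ofPred.1 hp)) (Set.mem_ofPred.1 (hsupp hp'))
  have houter : {p : ℝ × ℝ | p.2 < p.1 ^ 2} ⊆ outerFace (parabolaDrawing G f hf hG).support :=
    fun p hp => ⟨hbelow hp, fun hb => not_isBounded_below_parabola (hb.subset
      (isPreconnected_below_parabola.subset_connectedComponentIn hp hbelow))⟩
  refine closure_mono houter ?_
  have h0 : (0 : ℝ) ∈ closure (Set.Ioi 0) := by simp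
  have hcont : Continuous fun s : ℝ => (f v, f v ^ 2 - s) := by fun_prop
  have := map_mem_closure (t := {p : ℝ × ℝ | p.2 < p.1 ^ 2}) hcont h0 fun s hs => by
    show f v ^ 2 - s < f v ^ 2
    have : 0 < s := hs
    linarith
  simpa [parabolaDrawing] using this

/-! ## The graphs `T_d(P_n)` are outerplanar -/

/-- The number of vertices of `T_d(P_n)`. -/
def order (n : ℕ) : ℕ → ℕ
  | 0 => 1
  | d + 1 => 1 + n * order n d

/-- The position of a vertex of `T_d(P_n)` in the enumeration of its vertices where the handle
comes first, followed by the vertices of the copies of `T_{d-1}(P_n)`, copy by copy. -/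
def position {n : ℕ} : (d : ℕ) → TVert (Fin n) d → ℕ
  | 0, _ => 0
  | _ + 1, none => 0
  | d + 1, some (x, y) => 1 + (x * order n d + position d y)

theorem position_handle {n : ℕ} : ∀ d : ℕ, position d (handle (Fin n) d) = 0
  | 0 => rfl
  | _ + 1 => rfl

theorem mul_order_add_le {n : ℕ} (d : ℕ) {x y : ℕ} (h : x < y) :
    x * order n d + order n d ≤ y * order n d := by
  rw [← Nat.succ_mul]
  exact Nat.mul_le_mul_right _ h

theorem position_lt {n : ℕ} : ∀ (d : ℕ) (v : TVert (Fin n) d), position d v < order n d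
  | 0, _ => Nat.one_pos
  | d + 1, none => by simp [position, order]
  | d + 1, some (x, y) => by
      have := position_lt d y
      have := mul_order_add_le (n := n) d x.2
      simp only [position, order]
      omega

theorem position_injective {n : ℕ} : ∀ d : ℕ, Function.Injective (position (n := n) d)
  | 0, _, _, _ => rfl
  | d + 1, none, none, _ => rfl
  | d + 1, none, some (x, y), h => by simp only [position] at h; omega
  | d + 1, some (x, y), none, h => by simp only [position] at h; omega
  | d + 1, some (x, y), some (x', y'), h => by
      have h₁ := position_lt d y
      have h₂ := position_lt d y'
      simp only [position] at h
      have hx : x = x' := by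
        rcases lt_trichotomy (x : ℕ) x' with hx | hx | hx
        · have := mul_order_add_le (n := n) d hx
          omega
        · exact Fin.ext hx
        · have := mul_order_add_le (n := n) d hx
          omega
      subst hx
      rw [position_injective d (by omega : position d y = position d y')]

/-- The types of the edges of `T_{d+1}(P_n)`, in terms of the positions of the ends. -/
theorem position_of_adj {n d : ℕ} {u v : TVert (Fin n) (d + 1)}
    (h : (T (d + 1) (SimpleGraph.pathGraph n)).Adj u v)
    (hlt : position (d + 1) u < position (d + 1) v) :
    (∃ x : ℕ, position (d + 1) u = 0 ∧ position (d + 1) v = 1 + x * order n d) ∨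
    (∃ x : ℕ, position (d + 1) u = 1 + x * order n d ∧
      position (d + 1) v = 1 + (x * order n d + order n d)) ∨
    (∃ (x : ℕ) (y y' : TVert (Fin n) d), (T d (SimpleGraph.pathGraph n)).Adj y y' ∧
      position (d + 1) u = 1 + (x * order n d + position d y) ∧
      position (d + 1) v = 1 + (x * order n d + position d y')) := by
  rcases u with _ | ⟨x, y⟩ <;> rcases v with _ | ⟨x', y'⟩
  · exact absurd h (fun h => h)
  · obtain rfl : y' = handle (Fin n) d := h
    exact Or.inl ⟨x', rfl, by simp only [position, position_handle, add_zero]⟩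
  · exact absurd hlt (Nat.not_lt_zero _)
  · rcases h with ⟨rfl, h⟩ | ⟨h, rfl, rfl⟩
    · exact Or.inr (Or.inr ⟨x, y, y', h, rfl, rfl⟩)
    · simp only [position, position_handle, add_zero] at hlt ⊢
      refine Or.inr (Or.inl ⟨x, rfl, ?_⟩)
      rcases SimpleGraph.pathGraph_adj.1 h with h | h
      · rw [← h, Nat.succ_mul]
      · rw [← h, Nat.succ_mul] at hlt
        omega

theorem position_noncrossing {n : ℕ} : ∀ (d : ℕ) (u v u' v' : TVert (Fin n) d),
    (T d (SimpleGraph.pathGraph n)).Adj u v → (T d (SimpleGraph.pathGraph n)).Adj u' v' →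
    position d u < position d u' → position d u' < position d v → position d v < position d v' →
    False
  | 0, _, _, _, _, h, _ => fun _ _ _ => h
  | d + 1, u, v, u', v', h, h' => by
      intro h₁ h₂ h₃
      rcases position_of_adj h (h₁.trans h₂) with
        ⟨x, e₁, e₂⟩ | ⟨x, e₁, e₂⟩ | ⟨x, y, z, hyz, e₁, e₂⟩ <;>
      rcases position_of_adj h' (h₂.trans h₃) with
        ⟨x', e₁', e₂'⟩ | ⟨x', e₁', e₂'⟩ | ⟨x', y', z', hyz', e₁', e₂'⟩ <;>
      rcases lt_trichotomy x x' with hx | hx | hx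
      any_goals have := mul_order_add_le (n := n) d hx
      any_goals have := position_lt d y
      any_goals have := position_lt d z
      any_goals have := position_lt d y'
      any_goals have := position_lt d z'
      any_goals subst hx
      -- The ends of handle and path edges are `0` or starts of blocks, with a path edge spanning
      -- exactly one block, and a copy edge stays within its block. Only two edges of the same copy
      -- could cross, which is left to the induction.
      any_goals omega
      exact position_noncrossing d y z y' z' hyz hyz' (by omega) (by omega) (by omega)

theorem isOuterplanar_T (n d : ℕ) : IsOuterplanar (T d (SimpleGraph.pathGraph n)) :=
  isOuterplanar_of_noncrossing _ (fun v => (position d v : ℝ))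
    (Nat.cast_injective.comp (position_injective d)) fun u v u' v' h h' h₁ h₂ h₃ =>
      position_noncrossing d u v u' v' h h' (by exact_mod_cast h₁) (by exact_mod_cast h₂)
        (by exact_mod_cast h₃)

end TdFragile

theorem mainTheorem7 :
    -- the treedepth of `T_d(P_n)`
    (∀ d a n : ℕ, 1 ≤ a → 2 ^ a ≤ n →
      a * d + 1 ≤ TdFragile.treedepth (TdFragile.T d (SimpleGraph.pathGraph n))) ∧
    -- the graphs `T_d(P_d)` are outerplanar, and they witness the lower bound on the rate
    (∀ d : ℕ, TdFragile.IsOuterplanar (TdFragile.T d (SimpleGraph.pathGraph d))) ∧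
    (∃ c : ℝ, 0 < c ∧ ∃ a₀ : ℕ, ∀ a d : ℕ, a₀ ≤ a → a ≤ d →
      ∀ r : ℕ → ℝ≥0, Monotone r →
        TdFragile.FractionallyFragile TdFragile.td r
          (TdFragile.T d (SimpleGraph.pathGraph d)) →
        c * ((a : ℝ) * Real.log (a : ℝ)) ≤ (r a : ℝ)) ∧
    -- the lower bound for the class of all outerplanar graphs
    (∀ r : ℕ → ℝ≥0, Monotone r →
      (∀ (V : Type) [Fintype V] (G : SimpleGraph V), TdFragile.IsOuterplanar G →
        TdFragile.FractionallyFragile TdFragile.td r G) →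
      (fun a : ℕ => (a : ℝ) * Real.log (a : ℝ)) =O[Filter.atTop] (fun a : ℕ => (r a : ℝ))) := by
  refine ⟨fun d a n _ hn => TdFragile.le_of_treedepthLE_T hn d _ (TdFragile.treedepthLE_treedepth _),
    fun d => TdFragile.isOuterplanar_T d d,
    ⟨1 / 32, by norm_num, 256, fun a d ha had r _ h => h.mul_log_le ha had⟩, fun r _ h => ?_⟩
  refine Asymptotics.IsBigO.of_bound 32 ?_
  filter_upwards [Filter.eventually_ge_atTop 256] with a ha
  have hle := (h _ _ (TdFragile.isOuterplanar_T a a)).mul_log_le ha le_rfl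
  have hlog : 0 ≤ (a : ℝ) * Real.log a := mul_nonneg a.cast_nonneg (Real.log_natCast_nonneg a)
  rw [Real.norm_of_nonneg hlog, Real.norm_of_nonneg (r a).coe_nonneg]
  linarith
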